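/- A group $G$ is called \emph{capable} if there is a group $K$ with $G\cong K/Z(K)$. Let $p$ be a prime and let $G$ be a finite $p$-group of exponent $p$ whose nilpotency class is exactly two (so that $p$ is necessarily odd, and $G/Z(G)$ and $[G,G]$ are elementary abelian $p$-groups). Let $n$ be the rank of $G/Z(G)$ and $\ell$ the rank of $[G,G]$, where the rank of a group is its minimal number of generators. If $$\ell > \binom{n}{2} - 2\sqrt{n},$$ then $G$ is capable. -/

import Mathlib

universe u

/-- A group `G` is capable if it is isomorphic to `K / Z(K)` for some group `K`.
(A suitable `K` of cardinality at most `max |G| ℵ₀` exists as soon as any does, so it is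
no restriction to look for `K` in the universe of `G`.) -/
def IsCapable (G : Type u) [Group G] : Prop :=
  ∃ (K : Type u) (_ : Group K), Nonempty (G ≃* K ⧸ Subgroup.center K)

/-! `G` is capable as soon as every nontrivial `z` has a noncentral lift in some central extension.
Baer's trick turns `G` into an `F_p`-space `E` with `x * y = x + y + c x y`, `c` alternating and
with values in its own radical. A noncentral `z` needs no cocycle, and a central `z` outside the
span `L` of the values of `c` is handled by a product of two linear forms.

For `a = ε z` in `L`, take `Σ B_m(x) e_m(y)`, with `e` the coordinates on `E / ker c`. Its
coboundary is the trilinear function `Σ B_m(c x y) e_m(w)`, which a function of `e x, e y` can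
cancel if `B` satisfies a Jacobi identity. So some Jacobi family with `B_k a ≠ 0` is wanted.

If there is none, duality gives `n` linearly independent alternating three-dimensional arrays whose
slices lie in the space `Y` of skew matrices sent by `c` into the line of `a`. Here `dim Y ≤ C(n,2)
- ℓ + 1`. An induction bounds the dimension of the space of such arrays by `(dim Y - 1)^2 / 4`,
whence `4n ≤ (C(n,2) - ℓ)^2`, against the hypothesis. -/

/-! ### Capability through central extensions -/

/-- A group is capable if each nontrivial element has a noncentral lift to some central extension,
given by a normalized two-cocycle. -/
theorem isCapable_of_cocycles {G : Type u} [Group G] {A : Type} [AddCommGroup A]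
    (H : ∀ g : G, g ≠ 1 → ∃ f : G → G → A, (∀ x, f 1 x = 0) ∧
      (∀ x y z, f x y + f (x * y) z = f y z + f x (y * z)) ∧
      ∃ y, g * y ≠ y * g ∨ f g y ≠ f y g) : IsCapable G := by
  classical
  have H' : ∀ g : G, ∃ f : G → G → A, (∀ x, f 1 x = 0) ∧
      (∀ x y z, f x y + f (x * y) z = f y z + f x (y * z)) ∧
      (g ≠ 1 → ∃ y, g * y ≠ y * g ∨ f g y ≠ f y g) := by
    intro g
    by_cases hg : g = 1
    · exact ⟨fun _ _ => 0, by simp, by simp, fun h => absurd hg h⟩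
    · obtain ⟨f, h1, h2, h3⟩ := H g hg
      exact ⟨f, h1, h2, fun _ => h3⟩
  choose f f1 f2 f3 using H'
  -- All the cocycles are used at once: coordinate `g` of the kernel `G → A` carries the cocycle
  -- chosen for `g`.
  let _ : Mul (G × (G → A)) := ⟨fun a b => (a.1 * b.1, fun g => a.2 g + b.2 g + f g a.1 b.1)⟩
  let _ : One (G × (G → A)) := ⟨(1, 0)⟩
  let _ : Inv (G × (G → A)) := ⟨fun a => (a.1⁻¹, fun g => - a.2 g - f g a.1⁻¹ a.1)⟩
  have mul_def : ∀ a b : G × (G → A),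
    a * b = (a.1 * b.1, fun g => a.2 g + b.2 g + f g a.1 b.1) := fun _ _ => rfl
  have one_def : (1 : G × (G → A)) = (1, 0) := rfl
  have inv_def : ∀ a : G × (G → A), a⁻¹ = (a.1⁻¹, fun g => - a.2 g - f g a.1⁻¹ a.1) :=
    fun _ => rfl
  let _ : Group (G × (G → A)) := Group.ofLeftAxioms
    (by
      intro a b c
      simp only [mul_def, mul_assoc, Prod.mk.injEq, true_and]
      funext g
      have := f2 g a.1 b.1 c.1
      calc _ = a.2 g + b.2 g + c.2 g + (f g a.1 b.1 + f g (a.1 * b.1) c.1) := by abel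
        _ = _ := by rw [this]; abel)
    (by
      intro a
      simp [mul_def, one_def, f1])
    (by
      intro a
      simp only [mul_def, one_def, inv_def, inv_mul_cancel, Prod.mk.injEq, true_and]
      funext g
      simp only [Pi.zero_apply]
      abel)
  let π : (G × (G → A)) →* G :=
    { toFun := Prod.fst
      map_one' := rfl
      map_mul' := fun _ _ => rfl }
  have hπ : Function.Surjective π := fun g => ⟨(g, 0), rfl⟩
  have hf10 : ∀ g x, f g x 1 = 0 := by
    intro g x
    have := f2 g x 1 1
    simpa [f1] using this
  have hker : π.ker = Subgroup.center (G × (G → A)) := by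
    ext ⟨x, u⟩
    rw [MonoidHom.mem_ker, Subgroup.mem_center_iff]
    constructor
    · intro hx
      have hx : x = 1 := hx
      subst hx
      rintro ⟨y, v⟩
      simp only [mul_def, Prod.mk.injEq, mul_one, one_mul, true_and]
      funext g
      rw [f1, hf10, add_comm (v g)]
    · intro hx
      change x = 1
      by_contra hne
      obtain ⟨y, hy⟩ := f3 x hne
      have := hx (y, 0)
      simp only [mul_def, Prod.mk.injEq] at this
      rcases hy with hy | hy
      · exact hy this.1.symm
      · have h2 := congrFun this.2 x
        simp only [Pi.zero_apply, zero_add, add_zero, add_right_inj] at h2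
        exact hy h2.symm
  exact ⟨G × (G → A), inferInstance,
    ⟨((QuotientGroup.quotientMulEquivOfEq hker).symm.trans
      (QuotientGroup.quotientKerEquivOfSurjective π hπ)).symm⟩⟩

/-! ### Dimension bound for alternating arrays -/

/-- If `y₁ f` and `y₂ f` were proportional for every `f`, the ratio would not depend on `f`, and the
two forms would be dependent. -/
theorem exists_linearIndependent_apply_pair {F U : Type*} [Field F] [AddCommGroup U] [Module F U]
    {y₁ y₂ : U →ₗ[F] U →ₗ[F] F} (h1 : ∀ f, y₁ f f = 0) (h2 : ∀ f, y₂ f f = 0)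
    (hy : ∀ s t : F, s • y₁ + t • y₂ = 0 → s = 0 ∧ t = 0) : ∃ f, LinearIndependent F ![y₁ f, y₂ f] := by
  by_contra! hcon
  have key : ∀ f g h, y₁ f g * y₂ f h = y₁ f h * y₂ f g := by
    intro f g h
    have := hcon f
    rw [LinearIndependent.pair_iff] at this
    push Not at this
    obtain ⟨s, t, hst, hne⟩ := this
    have eg := LinearMap.congr_fun hst g
    have eh := LinearMap.congr_fun hst h
    simp only [LinearMap.add_apply, LinearMap.smul_apply, smul_eq_mul, LinearMap.zero_apply]
      at eg eh
    by_cases hs : s = 0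
    · have ht := hne hs
      simp only [hs, zero_mul, zero_add, mul_eq_zero, ht, false_or] at eg eh
      rw [eg, eh]; ring
    · apply mul_left_cancel₀ hs
      linear_combination (y₂ f h) * eg - (y₂ f g) * eh
  have hne1 : y₁ ≠ 0 := fun h => one_ne_zero (hy 1 0 (by rw [h]; simp)).1
  obtain ⟨f, g, hfg⟩ : ∃ f g, y₁ f g ≠ 0 := by
    by_contra! h0
    exact hne1 (LinearMap.ext₂ h0)
  have anti : ∀ (y : U →ₗ[F] U →ₗ[F] F), (∀ f, y f f = 0) → ∀ a b, y a b = - y b a := by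
    intro y hy a b
    have := hy (a + b)
    simp only [map_add, LinearMap.add_apply, hy] at this
    linear_combination this
  -- The combination vanishing at `(f, g)`. It is still pointwise proportional to `y₁`, which forces
  -- it to vanish identically.
  obtain ⟨z, hz⟩ : ∃ z, z = y₁ f g • y₂ - y₂ f g • y₁ := ⟨_, rfl⟩
  have hz0 : z = 0 := by
    have hzz : ∀ a, z a a = 0 := by intro a; simp [hz, h1, h2]
    have kz : ∀ a b c, y₁ a b * z a c = y₁ a c * z a b := by
      intro a b c
      simp only [hz, LinearMap.sub_apply, LinearMap.smul_apply, smul_eq_mul]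
      linear_combination (y₁ f g) * key a b c
    have zfg : z f g = 0 := by simp [hz]; ring
    have zf : ∀ h, z f h = 0 := by
      intro h
      have := kz f g h
      rw [zfg, mul_zero] at this
      exact (mul_eq_zero.1 this).resolve_left hfg
    have zg : ∀ h, z g h = 0 := by
      intro h
      have := kz g f h
      rw [anti z hzz g f, zfg, neg_zero, mul_zero, anti y₁ h1] at this
      exact (mul_eq_zero.1 this).resolve_left (neg_ne_zero.2 hfg)
    refine LinearMap.ext₂ fun a b => ?_
    have e1 := kz a g b
    have e2 := kz (f + a) g b
    have zag : z a g = 0 := by rw [anti z hzz, zg, neg_zero]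
    -- Comparing proportionality at `a` and at `f + a` isolates the nonzero factor `y₁ f g`.
    simp only [map_add, LinearMap.add_apply, zf, zag, add_zero, zero_add, mul_zero] at e1 e2
    have : y₁ f g * z a b = 0 := by linear_combination e2 - e1
    exact (mul_eq_zero.1 this).resolve_left hfg
  have := (hy (-(y₂ f g)) (y₁ f g) (by rw [← hz0, hz]; module)).2
  exact hfg this


section
variable {F ι : Type*} [Field F] [Fintype ι]

/-- The matrix `∑ i, f i • T i`. -/
def contractFirst (f : ι → F) : (ι → Matrix ι ι F) →ₗ[F] Matrix ι ι F :=
  ∑ i, f i • LinearMap.proj i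

theorem contractFirst_apply (f : ι → F) (T : ι → Matrix ι ι F) :
    contractFirst f T = ∑ i, f i • T i := by
  simp [contractFirst, LinearMap.sum_apply]

theorem contractFirst_add (f g : ι → F) (T : ι → Matrix ι ι F) :
    contractFirst (f + g) T = contractFirst f T + contractFirst g T := by
  simp [contractFirst_apply, add_smul, Finset.sum_add_distrib]

theorem contractFirst_single [DecidableEq ι] (i : ι) (T : ι → Matrix ι ι F) :
    contractFirst (Pi.single i 1) T = T i := by
  simp [contractFirst_apply, Pi.single_apply, ite_smul]

/-- Three-dimensional arrays, alternating in their first and last index, whose contractions lie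
in `Y`. -/
def alternatingArrays (Y : Submodule F (Matrix ι ι F)) : Submodule F (ι → Matrix ι ι F) where
  carrier := {T | ∀ f, contractFirst f T ∈ Y ∧ (contractFirst f T).mulVec f = 0}
  zero_mem' := fun f => by simp
  add_mem' := fun ha hb f => by
    rw [map_add, Matrix.add_mulVec, (ha f).2, (hb f).2, add_zero]
    exact ⟨Y.add_mem (ha f).1 (hb f).1, rfl⟩
  smul_mem' := fun c _ ha f => by
    rw [map_smul, Matrix.smul_mulVec, (ha f).2, smul_zero]
    exact ⟨Y.smul_mem c (ha f).1, rfl⟩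

/-- Multiplication of matrices with a fixed vector. -/
def mulVecRight (f : ι → F) : Matrix ι ι F →ₗ[F] (ι → F) where
  toFun y := y.mulVec f
  map_add' := fun a b => Matrix.add_mulVec a b f
  map_smul' := fun c a => Matrix.smul_mulVec c a f

/-- The matrices in `Y` annihilating the vector `f`. -/
def vectorAnnihilator (Y : Submodule F (Matrix ι ι F)) (f : ι → F) :
    Submodule F (Matrix ι ι F) :=
  Y ⊓ LinearMap.ker (mulVecRight f)

theorem mem_vectorAnnihilator {Y : Submodule F (Matrix ι ι F)} {f : ι → F} {y : Matrix ι ι F} :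
    y ∈ vectorAnnihilator Y f ↔ y ∈ Y ∧ y.mulVec f = 0 := Iff.rfl

/-- Contraction with `f` takes values in the annihilator of `f`. On its kernel, polarizing the
alternating law at `f + g` shows that every other contraction kills `f` too. -/
theorem finrank_alternatingArrays_le_add (Y : Submodule F (Matrix ι ι F)) (f : ι → F) :
    Module.finrank F (alternatingArrays Y) ≤
      Module.finrank F (vectorAnnihilator Y f) +
        Module.finrank F (alternatingArrays (vectorAnnihilator Y f)) := by
  let φ : alternatingArrays Y →ₗ[F] Matrix ι ι F :=
    (contractFirst f).comp (alternatingArrays Y).subtype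
  rw [← LinearMap.finrank_range_add_finrank_ker φ]
  apply Nat.add_le_add
  · apply Submodule.finrank_mono
    rintro _ ⟨T, rfl⟩
    exact mem_vectorAnnihilator.2 (T.2 f)
  · let ψ : LinearMap.ker φ →ₗ[F] (ι → Matrix ι ι F) :=
      (alternatingArrays Y).subtype.comp (LinearMap.ker φ).subtype
    have hψ : Function.Injective ψ :=
      Subtype.val_injective.comp Subtype.val_injective
    rw [← LinearMap.finrank_range_of_inj hψ]
    apply Submodule.finrank_mono
    rintro _ ⟨⟨T, hT⟩, rfl⟩
    have hT0 : contractFirst f T.1 = 0 := hT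
    refine fun g => ⟨mem_vectorAnnihilator.2 ⟨(T.2 g).1, ?_⟩, (T.2 g).2⟩
    have := (T.2 (f + g)).2
    rw [contractFirst_add, hT0, zero_add, Matrix.mulVec_add, (T.2 g).2, add_zero] at this
    exact this

theorem finrank_vectorAnnihilator_add (Y : Submodule F (Matrix ι ι F)) (f : ι → F) :
    Module.finrank F (vectorAnnihilator Y f) + Module.finrank F (Y.map (mulVecRight f)) =
      Module.finrank F Y := by
  have := LinearMap.finrank_range_add_finrank_ker ((mulVecRight f).comp Y.subtype)
  rw [LinearMap.range_comp, Submodule.range_subtype, LinearMap.ker_comp] at this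
  rw [← this, add_comm, vectorAnnihilator, ← Submodule.map_comap_subtype,
    Submodule.finrank_map_subtype_eq]

/-- A space of alternating arrays with contractions in a `k`-dimensional space of alternating
matrices has dimension at most `(k - 1) ^ 2 / 4`. -/
theorem four_mul_finrank_alternatingArrays_le (Y : Submodule F (Matrix ι ι F))
    (hY : ∀ y ∈ Y, ∀ f, y.mulVec f ⬝ᵥ f = 0) :
    4 * Module.finrank F (alternatingArrays Y) ≤ (Module.finrank F Y - 1) ^ 2 := by
  classical
  induction hk : Module.finrank F Y using Nat.strong_induction_on generalizing Y with
  | _ k ih =>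
  have hY' : ∀ f, ∀ y ∈ vectorAnnihilator Y f, ∀ g, y.mulVec g ⬝ᵥ g = 0 :=
    fun f y hy => hY y (mem_vectorAnnihilator.1 hy).1
  rcases Nat.lt_or_ge k 2 with h2 | h2
  -- When `dim Y ≤ 1`, the contractions by `f` and `g` are proportional. The one by `g` kills `g`,
  -- so the one by `f` does too.
  · have hJ : alternatingArrays Y = ⊥ := by
      rw [eq_bot_iff]
      intro T hT
      have hT3 : ∀ f g, (contractFirst f T).mulVec g = - (contractFirst g T).mulVec f := by
        intro f g
        have := (hT (f + g)).2
        rw [contractFirst_add, Matrix.mulVec_add, Matrix.add_mulVec, Matrix.add_mulVec,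
          (hT f).2, (hT g).2, zero_add, add_zero] at this
        exact eq_neg_of_add_eq_zero_right this
      rw [Submodule.mem_bot]
      by_contra hne
      obtain ⟨f, hf⟩ : ∃ f, contractFirst f T ≠ 0 := by
        by_contra! h0
        exact hne (funext fun i => by rw [← contractFirst_single i T, h0]; rfl)
      obtain ⟨g, hg⟩ : ∃ g, (contractFirst f T).mulVec g ≠ 0 := by
        by_contra! h0
        exact hf (Matrix.mulVec_injective (funext fun v => by rw [h0, Matrix.zero_mulVec]))
      have hg' : contractFirst g T ≠ 0 := fun h => hg (by rw [hT3, h]; simp)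
      obtain ⟨v, hv⟩ := finrank_le_one_iff.1 (show Module.finrank F Y ≤ 1 by omega)
      obtain ⟨s, hs⟩ := hv ⟨_, (hT f).1⟩
      obtain ⟨t, ht⟩ := hv ⟨_, (hT g).1⟩
      have hs := congrArg Subtype.val hs
      have ht := congrArg Subtype.val ht
      simp only [Submodule.coe_smul] at hs ht
      have ht0 : t ≠ 0 := by rintro rfl; exact hg' (by rw [← ht, zero_smul])
      have : v.1.mulVec g = 0 := by
        have h3 := (hT g).2
        rw [← ht, Matrix.smul_mulVec] at h3
        exact (smul_eq_zero.1 h3).resolve_left ht0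
      exact hg (by rw [← hs, Matrix.smul_mulVec, this, smul_zero])
    rw [hJ, finrank_bot]
    exact Nat.zero_le _
  -- Two independent forms in `Y` stay independent at a suitable `f`, so the annihilator of `f` has
  -- codimension at least two.
  · obtain ⟨f, hf⟩ : ∃ f, Module.finrank F (vectorAnnihilator Y f) + 2 ≤ k := by
      obtain ⟨s, hs⟩ := exists_linearIndependent_of_le_finrank (R := F) (M := Y) (n := 2)
        (by omega)
      have hs : LinearIndependent F ![s 0, s 1] := by
        convert hs using 1
        ext i : 1
        fin_cases i <;> rfl
      have happ : ∀ (y : Matrix ι ι F) (f g : ι → F),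
          Matrix.toLinearMap₂' F y.transpose f g = y.mulVec f ⬝ᵥ g := by
        intro y f g
        rw [Matrix.toLinearMap₂'_apply', Matrix.mulVec_transpose, dotProduct_comm,
          ← Matrix.dotProduct_mulVec, dotProduct_comm]
      obtain ⟨f, hf⟩ := exists_linearIndependent_apply_pair
        (y₁ := (Matrix.toLinearMap₂' F (s 0).1.transpose))
        (y₂ := (Matrix.toLinearMap₂' F (s 1).1.transpose))
        (fun f => by rw [happ]; exact hY _ (s 0).2 f) (fun f => by rw [happ]; exact hY _ (s 1).2 f)
        (by
          intro u v huv
          refine LinearIndependent.pair_iff.1 hs u v (Subtype.ext (Matrix.transpose_injective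
            ((Matrix.toLinearMap₂' F :
              Matrix ι ι F ≃ₗ[F] (ι → F) →ₗ[F] (ι → F) →ₗ[F] F).injective ?_)))
          simpa using huv)
      refine ⟨f, ?_⟩
      rw [← hk, ← finrank_vectorAnnihilator_add Y f]
      apply Nat.add_le_add_left
      have hf' : LinearIndependent F ![(s 0).1.mulVec f, (s 1).1.mulVec f] := by
        rw [LinearIndependent.pair_iff] at hf ⊢
        intro u v huv
        refine hf u v (LinearMap.ext fun g => ?_)
        rw [LinearMap.add_apply, LinearMap.smul_apply, LinearMap.smul_apply, happ, happ,
          ← smul_dotProduct, ← smul_dotProduct, ← add_dotProduct, huv, zero_dotProduct,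
          LinearMap.zero_apply]
      have hspan := finrank_span_eq_card hf'
      rw [Fintype.card_fin] at hspan
      refine hspan.ge.trans ?_
      apply Submodule.finrank_mono
      rw [Submodule.span_le]
      rintro _ ⟨i, rfl⟩
      fin_cases i
      · exact ⟨_, (s 0).2, rfl⟩
      · exact ⟨_, (s 1).2, rfl⟩
    have h1 := finrank_alternatingArrays_le_add Y f
    have h3 := ih _ (by omega) (vectorAnnihilator Y f) (hY' f) rfl
    generalize Module.finrank F (vectorAnnihilator Y f) = d at *
    rcases d with _ | d
    · simp only [zero_tsub, ne_eq, OfNat.ofNat_ne_zero, not_false_eq_true, zero_pow] at h3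
      have : Module.finrank F (alternatingArrays Y) = 0 := by omega
      rw [this]; exact Nat.zero_le _
    -- The extreme case `j = 0` is the identity `4(k - 2) + (k - 3)^2 = (k - 1)^2`.
    · obtain ⟨j, rfl⟩ : ∃ j, k = d + 3 + j := ⟨k - (d + 3), by omega⟩
      have e1 : d + 3 + j - 1 = d + 2 + j := by omega
      rw [e1]
      simp only [Nat.add_sub_cancel] at h3
      nlinarith
end

/-! ### Trilinear coboundaries -/

/-- The trilinear functions that are coboundaries of normalized two-cochains. -/
def trilinearCoboundaries (F W : Type*) [Field F] [AddCommGroup W] :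
    Submodule F (W → W → W → F) where
  carrier := {T | ∃ q : W → W → F, (∀ y, q 0 y = 0) ∧ (∀ x, q x 0 = 0) ∧
    ∀ x y z, q x y + q (x + y) z - q y z - q x (y + z) = T x y z}
  zero_mem' := ⟨fun _ _ => 0, by simp⟩
  add_mem' := by
    rintro S T ⟨q, q1, q2, q3⟩ ⟨r, r1, r2, r3⟩
    refine ⟨fun x y => q x y + r x y, by simp [q1, r1], by simp [q2, r2], fun x y z => ?_⟩
    simp only [Pi.add_apply, ← q3, ← r3]
    ring
  smul_mem' := by
    rintro a T ⟨q, q1, q2, q3⟩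
    refine ⟨fun x y => a * q x y, by simp [q1], by simp [q2], fun x y z => ?_⟩
    simp only [Pi.smul_apply, smul_eq_mul, ← q3]
    ring

section
variable {F ι : Type*} [Field F]

/-- The function `x i * y j * z k` of three vectors. -/
def coordMonomial (F : Type*) {ι : Type*} [Field F] (i j k : ι) :
    (ι → F) → (ι → F) → (ι → F) → F := fun x y z => x i * y j * z k

theorem coordMonomial_add_swap_left (i j k : ι) :
    coordMonomial F i j k + coordMonomial F j i k ∈ trilinearCoboundaries F (ι → F) := by
  refine ⟨fun x y => x i * x j * y k, by simp, by simp, fun x y z => ?_⟩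
  simp only [coordMonomial, Pi.add_apply]
  ring

theorem coordMonomial_add_swap_right (i j k : ι) :
    coordMonomial F i j k + coordMonomial F i k j ∈ trilinearCoboundaries F (ι → F) := by
  refine ⟨fun x y => - (x i * y j * y k), by simp, by simp, fun x y z => ?_⟩
  simp only [coordMonomial, Pi.add_apply]
  ring

/-- Triples of distinct indices are grouped by their increasing rearrangement, giving two cyclic
orbits each. Averaging over rotations would require dividing by 3, which fails for `p = 3`. -/
theorem sum_eq_zero_of_cyclic {Q : Type*} [AddCommGroup Q] [Fintype ι] [LinearOrder ι]
    (f : ι → ι → ι → Q) (h1 : ∀ i k, f i i k = 0) (h2 : ∀ i j, f i j j = 0)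
    (h3 : ∀ i j, f i j i = 0) (hc : ∀ i j k, f i j k + f j k i + f k i j = 0) :
    ∑ i, ∑ j, ∑ k, f i j k = 0 := by
  let P : (ι → ι → ι → Q) → ι → ι → ι → Q := fun g i j k => if i < j ∧ j < k then g i j k else 0
  have hP : ∀ g i j k, P g i j k = if i < j ∧ j < k then g i j k else 0 := fun _ _ _ _ => rfl
  have key : ∀ i j k, f i j k = P f i j k + P (fun i k j => f i j k) i k j
      + P (fun j i k => f i j k) j i k + P (fun j k i => f i j k) j k i
      + P (fun k i j => f i j k) k i j + P (fun k j i => f i j k) k j i := by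
    intro i j k
    simp only [hP]
    rcases lt_trichotomy i j with hij | hij | hij
    · rcases lt_trichotomy j k with hjk | hjk | hjk
      · simp [hij, hjk, hij.not_gt, hjk.not_gt, (hij.trans hjk).not_gt]
      · subst hjk; simp [h2]
      · rcases lt_trichotomy i k with hik | hik | hik
        · simp [hij, hjk, hik, hij.not_gt, hjk.not_gt, hik.not_gt]
        · subst hik; simp [h3]
        · simp [hij, hjk, hik, hij.not_gt, hjk.not_gt, hik.not_gt]
    · subst hij; simp [h1]
    · rcases lt_trichotomy j k with hjk | hjk | hjk
      · rcases lt_trichotomy i k with hik | hik | hik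
        · simp [hij, hjk, hik, hij.not_gt, hjk.not_gt, hik.not_gt]
        · subst hik; simp [h3]
        · simp [hij, hjk, hik, hij.not_gt, hjk.not_gt, hik.not_gt]
      · subst hjk; simp [h2]
      · simp [hij, hjk, hij.not_gt, hjk.not_gt, (hjk.trans hij).not_gt]
  have c23 : ∀ g : ι → ι → ι → Q, ∑ i, ∑ j, ∑ k, g i k j = ∑ i, ∑ j, ∑ k, g i j k :=
    fun g => Finset.sum_congr rfl fun i _ => Finset.sum_comm
  have c12 : ∀ g : ι → ι → ι → Q, ∑ i, ∑ j, ∑ k, g j i k = ∑ i, ∑ j, ∑ k, g i j k :=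
    fun g => Finset.sum_comm
  rw [Finset.sum_congr rfl fun i _ => Finset.sum_congr rfl fun j _ =>
    Finset.sum_congr rfl fun k _ => key i j k]
  simp only [Finset.sum_add_distrib]
  rw [c23 (P _), c12 (P _), c12 (fun i j k => P (fun j k i => f i j k) i k j), c23 (P _),
    c23 (fun i j k => P (fun k i j => f i j k) j i k), c12 (P _),
    c12 (fun i j k => P (fun k j i => f i j k) k i j),
    c23 (fun i j k => P (fun k j i => f i j k) j i k), c12 (P _)]
  simp only [← Finset.sum_add_distrib]
  refine Finset.sum_eq_zero fun i _ => Finset.sum_eq_zero fun j _ =>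
    Finset.sum_eq_zero fun k _ => ?_
  simp only [hP]
  split_ifs
  · rw [← add_zero (0 : Q)]
    nth_rewrite 1 [← hc i j k]
    rw [← hc j i k]
    abel
  · simp

/-- Modulo coboundaries the monomials change sign under adjacent swaps. They are therefore invariant
under rotation and vanish on repeated indices, so the cyclic relation kills the sum. -/
theorem sum_coordMonomial_mem_trilinearCoboundaries [Fintype ι] [LinearOrder ι]
    (h2 : (2 : F) ≠ 0) (t : ι → ι → ι → F)
    (hc : ∀ i j k, t i j k + t j k i + t k i j = 0) :
    ∑ i, ∑ j, ∑ k, t i j k • coordMonomial F i j k ∈ trilinearCoboundaries F (ι → F) := by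
  rw [← Submodule.Quotient.mk_eq_zero, ← Submodule.mkQ_apply]
  let w : ι → ι → ι → ((ι → F) → (ι → F) → (ι → F) → F) ⧸ trilinearCoboundaries F (ι → F) :=
    fun i j k => (trilinearCoboundaries F (ι → F)).mkQ (coordMonomial F i j k)
  have w1 : ∀ i j k, w i j k = - w j i k := by
    intro i j k
    rw [eq_neg_iff_add_eq_zero, ← map_add, Submodule.mkQ_apply, Submodule.Quotient.mk_eq_zero]
    exact coordMonomial_add_swap_left i j k
  have w2 : ∀ i j k, w i j k = - w i k j := by
    intro i j k
    rw [eq_neg_iff_add_eq_zero, ← map_add, Submodule.mkQ_apply, Submodule.Quotient.mk_eq_zero]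
    exact coordMonomial_add_swap_right i j k
  have hself : ∀ v : ((ι → F) → (ι → F) → (ι → F) → F) ⧸ trilinearCoboundaries F (ι → F),
      v = - v → v = 0 := by
    intro v hv
    have : (2 : F) • v = 0 := by rw [two_smul, ← eq_neg_iff_add_eq_zero]; exact hv
    exact (smul_eq_zero.1 this).resolve_left h2
  have wc : ∀ i j k, w j k i = w i j k := by
    intro i j k
    rw [w2, w1, neg_neg]
  have e1 : ∀ i k, w i i k = 0 := fun i k => hself _ (w1 i i k)
  have e2 : ∀ i j, w i j j = 0 := fun i j => hself _ (w2 i j j)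
  have e3 : ∀ i j, w i j i = 0 := fun i j => by rw [w2, e1, neg_zero]
  simp only [map_sum, map_smul]
  refine sum_eq_zero_of_cyclic (fun i j k => t i j k • w i j k) ?_ ?_ ?_ ?_
  · simp [e1]
  · simp [e2]
  · simp [e3]
  · intro i j k
    rw [wc i j k, show w k i j = w i j k by rw [← wc k i j], ← add_smul, ← add_smul, hc, zero_smul]
end

/-! ### Skew matrices and duality for Jacobi families -/

section
variable {F : Type*} [Field F]

/-- The space of skew-symmetric matrices. -/
def skewMatrices (F ι : Type*) [Field F] : Submodule F (Matrix ι ι F) where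
  carrier := {y | ∀ i j, y i j = - y j i}
  zero_mem' := fun _ _ => by simp
  add_mem' := fun {a b} ha hb i j => by rw [Matrix.add_apply, ha, hb, Matrix.add_apply]; ring
  smul_mem' := fun c a ha i j => by
    rw [Matrix.smul_apply, ha, Matrix.smul_apply, smul_neg]

theorem finrank_skewMatrices_le (h2 : (2 : F) ≠ 0) (n : ℕ) :
    Module.finrank F (skewMatrices F (Fin n)) ≤ n.choose 2 := by
  let φ : skewMatrices F (Fin n) →ₗ[F] ((Σ i : Fin n, Fin i) → F) :=
    { toFun := fun y p => y.1 p.1 (Fin.castLE p.1.2.le p.2)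
      map_add' := fun _ _ => rfl
      map_smul' := fun _ _ => rfl }
  have hφ : Function.Injective φ := by
    rw [injective_iff_map_eq_zero]
    rintro ⟨y, hy⟩ h0
    have hlt : ∀ i j : Fin n, j < i → y i j = 0 := fun i j hij => congrFun h0 ⟨i, ⟨j, hij⟩⟩
    refine Subtype.ext (Matrix.ext fun i j => ?_)
    change y i j = 0
    rcases lt_trichotomy i j with h | rfl | h
    · rw [hy, hlt j i h, neg_zero]
    · have h3 : y i i = - y i i := hy i i
      have : 2 * y i i = 0 := by linear_combination h3
      exact (mul_eq_zero.1 this).resolve_left h2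
    · exact hlt i j h
  refine (LinearMap.finrank_le_finrank_of_injective hφ).trans ?_
  rw [Module.finrank_fintype_fun_eq_card, Fintype.card_sigma]
  simp only [Fintype.card_fin]
  rw [Fin.sum_univ_eq_sum_range (fun i => i) n, Finset.sum_range_id, Nat.choose_two_right]

theorem sum_mul_eq_zero_of_skew {ι : Type*} [Fintype ι] (h2 : (2 : F) ≠ 0) (f : ι → F)
    (s : ι → ι → F) (hs : ∀ i j, s i j = - s j i) : ∑ i, ∑ j, f i * s i j * f j = 0 := by
  have : ∑ i, ∑ j, f i * s i j * f j = - ∑ i, ∑ j, f i * s i j * f j := by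
    conv_lhs => rw [Finset.sum_comm]
    simp only [← Finset.sum_neg_distrib]
    refine Finset.sum_congr rfl fun i _ => Finset.sum_congr rfl fun j _ => ?_
    rw [hs]; ring
  have h : 2 * ∑ i, ∑ j, f i * s i j * f j = 0 := by linear_combination this
  exact (mul_eq_zero.1 h).resolve_left h2

variable {E : Type*} [AddCommGroup E] [Module F E]

/-- The linear combination of the vectors `c i j` with the entries of a matrix. -/
def matrixCombination {ι : Type*} [Fintype ι] (c : ι → ι → E) : Matrix ι ι F →ₗ[F] E where
  toFun y := ∑ i, ∑ j, y i j • c i j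
  map_add' a b := by simp [add_smul, Finset.sum_add_distrib]
  map_smul' r a := by simp [mul_smul, Finset.smul_sum]

theorem matrixCombination_apply {ι : Type*} [Fintype ι] (c : ι → ι → E) (y : Matrix ι ι F) :
    matrixCombination c y = ∑ i, ∑ j, y i j • c i j := rfl

/-- The map from skew matrices to `E` covers the span of the `c i j`, which bounds its kernel.
Allowing values in a line adds at most one dimension. -/
theorem finrank_skew_comap_span_singleton_le [FiniteDimensional F E] (h2 : (2 : F) ≠ 0) {n : ℕ}
    (c : Fin n → Fin n → E) (hc : ∀ i j, c i j = - c j i) (a : E) :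
    Module.finrank F (skewMatrices F (Fin n) ⊓ (Submodule.span F {a}).comap
      (matrixCombination c) : Submodule F (Matrix (Fin n) (Fin n) F)) ≤
      n.choose 2 - Module.finrank F (Submodule.span F (Set.range fun p : Fin n × Fin n =>
        c p.1 p.2)) + 1 := by
  set S := skewMatrices F (Fin n) with hS
  set Y : Submodule F (Matrix (Fin n) (Fin n) F) :=
    S ⊓ (Submodule.span F {a}).comap (matrixCombination c) with hY
  let φ : S →ₗ[F] E := (matrixCombination c).comp S.subtype
  let ψ : Y →ₗ[F] E := (matrixCombination c).comp Y.subtype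
  have hφ : Submodule.span F (Set.range fun p : Fin n × Fin n => c p.1 p.2) ≤
      LinearMap.range φ := by
    rw [Submodule.span_le]
    rintro _ ⟨⟨i, j⟩, rfl⟩
    refine ⟨⟨(2 : F)⁻¹ • (Matrix.single i j 1 - Matrix.single j i 1), ?_⟩, ?_⟩
    · refine S.smul_mem _ fun k l => ?_
      simp only [Matrix.sub_apply, Matrix.single_apply]
      rw [neg_sub]
      exact congrArg₂ (· - ·) (if_congr and_comm rfl rfl) (if_congr and_comm rfl rfl)
    · change matrixCombination c ((2 : F)⁻¹ • (Matrix.single i j (1 : F) - Matrix.single j i 1)) =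
        c i j
      have hsing : ∀ i j, matrixCombination c (Matrix.single i j (1 : F)) = c i j := by
        intro i j
        rw [matrixCombination_apply, Finset.sum_eq_single i, Finset.sum_eq_single j]
        · simp
        · intro b _ hb; simp [hb.symm]
        · simp
        · intro b _ hb; simp [hb.symm]
        · simp
      rw [map_smul, map_sub, hsing, hsing, hc j i, sub_neg_eq_add, ← two_smul F, smul_smul,
        inv_mul_cancel₀ h2, one_smul]
  have hφ' := Submodule.finrank_mono hφ
  have rφ := LinearMap.finrank_range_add_finrank_ker φ
  have rψ := LinearMap.finrank_range_add_finrank_ker ψ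
  have hS' := finrank_skewMatrices_le h2 n
  have hψ : Module.finrank F (LinearMap.range ψ) ≤ 1 := by
    refine (Submodule.finrank_mono (t := Submodule.span F {a}) ?_).trans
      ((finrank_span_le_card ({a} : Set E)).trans (by simp))
    rintro _ ⟨y, rfl⟩
    exact y.2.2
  have hker : Module.finrank F (LinearMap.ker ψ) ≤ Module.finrank F (LinearMap.ker φ) := by
    let θ : LinearMap.ker ψ →ₗ[F] LinearMap.ker φ :=
      { toFun := fun y => ⟨⟨y.1.1, y.1.2.1⟩, y.2⟩
        map_add' := fun _ _ => rfl
        map_smul' := fun _ _ => rfl }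
    refine LinearMap.finrank_le_finrank_of_injective (f := θ) fun x y hxy => ?_
    exact Subtype.ext (Subtype.ext (congrArg (fun z => z.1.1) hxy))
  rw [← hS] at hS'
  omega

/-- Double annihilator: evaluation at `(k, a)` is a combination of the Jacobi functionals, and its
coefficients, symmetrized cyclically and then antisymmetrized, form the array. -/
theorem exists_alternating_of_forall_jacobi [FiniteDimensional F E] {ι : Type*} [Fintype ι]
    [DecidableEq ι] (c : ι → ι → E) (hc : ∀ i j, c i j = - c j i) (a : E) (k : ι)
    (h : ∀ B : ι → Module.Dual F E,
      (∀ i j l, B l (c i j) + B i (c j l) + B j (c l i) = 0) → B k a = 0) :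
    ∃ w : ι → Matrix ι ι F, (∀ l i j, w l i j = - w l j i) ∧ (∀ l i j, w l i j = - w i l j) ∧
      ∀ l, matrixCombination c (w l) = if l = k then (2 : F) • a else 0 := by
  let ev : ι → E → Module.Dual F (ι → Module.Dual F E) := fun k a =>
    (Module.Dual.eval F E a).comp (LinearMap.proj k)
  let τ : ι × ι × ι → Module.Dual F (ι → Module.Dual F E) := fun p =>
    ev p.2.2 (c p.1 p.2.1) + ev p.1 (c p.2.1 p.2.2) + ev p.2.1 (c p.2.2 p.1)
  have hmem : ev k a ∈ Submodule.span F (Set.range τ) := by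
    apply mem_span_of_iInf_ker_le_ker
    intro B hB
    rw [Submodule.mem_iInf] at hB
    exact h B fun i j l => hB (i, j, l)
  obtain ⟨t, ht⟩ := (Submodule.mem_span_range_iff_exists_fun F).1 hmem
  let s : ι → ι → ι → F := fun l i j => t (l, i, j) + t (i, j, l) + t (j, l, i)
  have hs : ∀ l i j, s l i j = s i j l := fun l i j => by simp only [s]; ring
  have hsum : ∀ l, matrixCombination c (Matrix.of (s l)) = if l = k then a else 0 := by
    intro l
    rw [← sub_eq_zero, ← Module.forall_dual_apply_eq_zero_iff F]
    -- Testing on the family `B` concentrated at `l` with value `β` extracts slice `l` of the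
    -- relation.
    intro β
    have hev : ∀ m x, ev m x (Pi.single l β) = if m = l then β x else 0 := by
      intro m x
      change (Pi.single l β : ι → Module.Dual F E) m x = _
      rw [Pi.single_apply]
      split_ifs <;> rfl
    have h0 := LinearMap.congr_fun ht (Pi.single l β)
    simp only [LinearMap.sum_apply, LinearMap.smul_apply, Fintype.sum_prod_type, τ,
      LinearMap.add_apply, hev, smul_eq_mul, mul_add, mul_ite, mul_zero, Finset.sum_add_distrib,
      Finset.sum_ite_eq', Finset.mem_univ, if_true] at h0
    have h1 : ∀ g : ι → ι → ι → F, ∑ i, ∑ j, ∑ m, (if i = l then g i j m else 0) =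
        ∑ j, ∑ m, g l j m := by
      intro g
      rw [Finset.sum_eq_single l]
      · simp
      · intro b _ hb; simp [hb]
      · simp
    have h2 : ∀ g : ι → ι → ι → F, ∑ i, ∑ j, ∑ m, (if j = l then g i j m else 0) =
        ∑ i, ∑ m, g i l m := by
      intro g
      refine Finset.sum_congr rfl fun i _ => ?_
      rw [Finset.sum_eq_single l]
      · simp
      · intro b _ hb; simp [hb]
      · simp
    rw [h1 fun i j m => t (i, j, m) * β (c j m), h2 fun i j m => t (i, j, m) * β (c m i),
      Finset.sum_comm (f := fun i m => t (i, l, m) * β (c m i))] at h0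
    simp only [eq_comm (a := k)] at h0
    rw [map_sub, sub_eq_zero, apply_ite β, map_zero, ← h0, matrixCombination_apply]
    simp only [map_sum, map_smul, Matrix.of_apply, s, smul_eq_mul, add_mul,
      Finset.sum_add_distrib]
    ring
  refine ⟨fun l => Matrix.of (s l) - (Matrix.of (s l)).transpose, ?_, ?_, ?_⟩
  · intro l i j
    simp
  · intro l i j
    simp only [Matrix.sub_apply, Matrix.of_apply, Matrix.transpose_apply]
    rw [hs l i j, hs l j i, hs j i l]
    ring
  · intro l
    -- Skewness of `c` makes the transpose contribute the same again, hence the factor 2.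
    have htr : matrixCombination c (Matrix.of (s l)).transpose =
        - matrixCombination c (Matrix.of (s l)) := by
      rw [matrixCombination_apply, matrixCombination_apply, Finset.sum_comm]
      simp only [← Finset.sum_neg_distrib]
      refine Finset.sum_congr rfl fun i _ => Finset.sum_congr rfl fun j _ => ?_
      rw [Matrix.transpose_apply, hc, smul_neg]
    rw [map_sub, htr, hsum, sub_neg_eq_add]
    split_ifs
    · rw [two_smul]
    · simp

theorem exists_jacobi_apply_ne_zero [FiniteDimensional F E] (h2 : (2 : F) ≠ 0) {n : ℕ}
    (c : Fin n → Fin n → E) (hc : ∀ i j, c i j = - c j i) {a : E} (ha : a ≠ 0)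
    (hn : (n.choose 2 - Module.finrank F (Submodule.span F
      (Set.range fun p : Fin n × Fin n => c p.1 p.2))) ^ 2 < 4 * n) :
    ∃ B : Fin n → Module.Dual F E,
      (∀ i j l, B l (c i j) + B i (c j l) + B j (c l i) = 0) ∧ ∃ k, B k a ≠ 0 := by
  by_contra! hcon
  choose w w1 w2 w3 using fun k => exists_alternating_of_forall_jacobi c hc a k
    (fun B hB => hcon B hB k)
  set Y : Submodule F (Matrix (Fin n) (Fin n) F) :=
    skewMatrices F (Fin n) ⊓ (Submodule.span F {a}).comap (matrixCombination c) with hYdef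
  have hY := finrank_skew_comap_span_singleton_le h2 c hc a
  rw [← hYdef] at hY
  have hYalt : ∀ y ∈ Y, ∀ f, y.mulVec f ⬝ᵥ f = 0 := by
    intro y hy f
    rw [← sum_mul_eq_zero_of_skew h2 f (fun i j => y i j) hy.1]
    simp only [dotProduct, Matrix.mulVec, Finset.sum_mul]
    exact Finset.sum_congr rfl fun i _ => Finset.sum_congr rfl fun j _ => by ring
  have hJ := four_mul_finrank_alternatingArrays_le Y hYalt
  have hw : ∀ k, w k ∈ alternatingArrays Y := by
    intro k f
    constructor
    · rw [contractFirst_apply]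
      refine Y.sum_mem fun l _ => Y.smul_mem _ ⟨w1 k l, ?_⟩
      change matrixCombination c (w k l) ∈ Submodule.span F {a}
      rw [w3]
      split_ifs
      · exact Submodule.smul_mem _ _ (Submodule.mem_span_singleton_self a)
      · exact Submodule.zero_mem _
    · ext i
      rw [Pi.zero_apply, ← sum_mul_eq_zero_of_skew h2 f (fun l j => w k l i j)
        (fun l j => by rw [w1, w2, w1, w2 k j i l, neg_neg, neg_neg])]
      simp only [contractFirst_apply, Matrix.mulVec, dotProduct, Matrix.sum_apply,
        Matrix.smul_apply, smul_eq_mul, Finset.sum_mul]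
      exact Finset.sum_comm
  -- Combining slices with `c` sends `w k` to `2a` in position `k` and zero elsewhere, which
  -- separates the arrays.
  let Ψ : alternatingArrays Y →ₗ[F] (Fin n → E) :=
    (LinearMap.pi fun l => (matrixCombination c).comp (LinearMap.proj l)).comp
      (alternatingArrays Y).subtype
  have hli : LinearIndependent F (fun k => (⟨w k, hw k⟩ : alternatingArrays Y)) := by
    rw [Fintype.linearIndependent_iff]
    intro g hg k
    have h3 := congrFun (congrArg Ψ hg) k
    rw [map_sum, Finset.sum_apply, Finset.sum_eq_single k] at h3
    · have h4 : g k • (2 : F) • a = 0 := by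
        rw [map_smul, map_zero] at h3
        have h5 : Ψ ⟨w k, hw k⟩ k = (2 : F) • a := by
          change matrixCombination c (w k k) = _
          rw [w3, if_pos rfl]
        rw [← h5]; exact h3
      exact (smul_eq_zero.1 h4).resolve_right (smul_ne_zero h2 ha)
    · intro b _ hb
      have h5 : Ψ ⟨w b, hw b⟩ k = 0 := by
        change matrixCombination c (w b k) = _
        rw [w3, if_neg hb.symm]
      rw [map_smul, Pi.smul_apply, h5, smul_zero]
    · simp
  have hcard := hli.fintype_card_le_finrank
  rw [Fintype.card_fin] at hcard
  -- The `- 1` of the array bound absorbs the dimension contributed by the line of `a`.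
  have : (Module.finrank F Y - 1) ^ 2 ≤ (n.choose 2 - Module.finrank F (Submodule.span F
      (Set.range fun p : Fin n × Fin n => c p.1 p.2))) ^ 2 := Nat.pow_le_pow_left (by omega) 2
  omega
end

/-! ### Baer's correspondence -/

section
open Subgroup commutatorElement

theorem commutatorElement_mul_left_of_class_two {G : Type*} [Group G]
    (hG : ∀ x y : G, ⁅x, y⁆ ∈ center G) (x y z : G) : ⁅x * y, z⁆ = ⁅x, z⁆ * ⁅y, z⁆ := by
  have h := mem_center_iff.1 (hG y z) x
  calc ⁅x * y, z⁆ = x * ⁅y, z⁆ * (z * x⁻¹ * z⁻¹) := by simp only [commutatorElement_def]; group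
    _ = ⁅y, z⁆ * ⁅x, z⁆ := by rw [h]; simp only [commutatorElement_def]; group
    _ = ⁅x, z⁆ * ⁅y, z⁆ := (mem_center_iff.1 (hG y z) _).symm

theorem commutatorElement_mul_right_of_class_two {G : Type*} [Group G]
    (hG : ∀ x y : G, ⁅x, y⁆ ∈ center G) (x y z : G) : ⁅x, y * z⁆ = ⁅x, y⁆ * ⁅x, z⁆ := by
  rw [← inv_inj, mul_inv_rev, commutatorElement_inv, commutatorElement_inv, commutatorElement_inv,
    commutatorElement_mul_left_of_class_two hG]
  exact ((mem_center_iff.1 (hG z x)) _)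

/-- A biadditive map of `ZMod n`-modules as a bilinear map. -/
def zmodBilinear (n : ℕ) {M N : Type*} [AddCommGroup M] [Module (ZMod n) M] [AddCommGroup N]
    [Module (ZMod n) N] (c : M →+ M →+ N) : M →ₗ[ZMod n] M →ₗ[ZMod n] N :=
  LinearMap.mk₂ (ZMod n) (fun x y => c x y) (fun x y z => by rw [map_add, AddMonoidHom.add_apply])
    (fun r x y => ZMod.map_smul (c.flip y) r x) (fun x y z => map_add (c x) y z)
    (fun r x y => ZMod.map_smul (c x) r y)

/-- Baer's addition on a group of class two and odd prime exponent: the group operation becomes a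
commutative addition twisted by an alternating biadditive map. -/
theorem exists_baer_addCommGroup {p : ℕ} [hp : Fact p.Prime] (hp2 : p ≠ 2) {G : Type*} [Group G]
    (hG : ∀ x y : G, ⁅x, y⁆ ∈ center G) (hexp : ∀ x : G, x ^ p = 1) :
    ∃ (_ : AddCommGroup G) (c : G →+ G →+ G), (∀ x : G, p • x = 0) ∧
      (∀ x y, x * y = x + y + c x y) ∧ (∀ x, c x x = 0) ∧ ∀ x y z, c x (c y z) = 0 := by
  -- `h` is the inverse of 2 modulo `p`, so `d` is the square root of the commutator.
  obtain ⟨h, hh⟩ : ∃ h, 2 * h = p + 1 := by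
    obtain ⟨k, hk⟩ := hp.out.odd_of_ne_two hp2
    exact ⟨k + 1, by omega⟩
  let d : G → G → G := fun x y => ⁅x, y⁆ ^ h
  have d_cen : ∀ x y, d x y ∈ center G := fun x y => pow_mem (hG x y) h
  have dl : ∀ x y z, d (x * y) z = d x z * d y z := by
    intro x y z
    simp only [d, commutatorElement_mul_left_of_class_two hG]
    exact (Commute.mul_pow (mem_center_iff.1 (hG y z) _) h)
  have dr : ∀ x y z, d x (y * z) = d x y * d x z := by
    intro x y z
    simp only [d, commutatorElement_mul_right_of_class_two hG]
    exact (Commute.mul_pow (mem_center_iff.1 (hG x z) _) h)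
  have dcl : ∀ x y, x ∈ center G → d x y = 1 := by
    intro x y hx
    simp only [d, commutatorElement_eq_one_iff_mul_comm.2 (mem_center_iff.1 hx y).symm, one_pow]
  have dinv : ∀ x y, d x y = (d y x)⁻¹ := by
    intro x y
    simp only [d, ← inv_pow, commutatorElement_inv]
  have dcr : ∀ x y, y ∈ center G → d x y = 1 := fun x y hy => by
    rw [dinv, dcl y x hy, inv_one]
  have dself : ∀ x, d x x = 1 := fun x => by simp [d]
  have dsq : ∀ x y, d x y * d x y = ⁅x, y⁆ := by
    intro x y
    simp only [d]
    rw [← pow_add, ← two_mul, hh, pow_succ, hexp, one_mul]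
  have dpow : ∀ x y : G, ∀ g, d x y * g = g * d x y := fun x y g =>
    (mem_center_iff.1 (d_cen x y) g).symm
  let _ : Add G := ⟨fun x y => x * y * d y x⟩
  let _ : Zero G := ⟨1⟩
  let _ : Neg G := ⟨fun x => x⁻¹⟩
  have add_def : ∀ x y : G, x + y = x * y * d y x := fun _ _ => rfl
  have zero_def : (0 : G) = 1 := rfl
  have neg_def : ∀ x : G, -x = x⁻¹ := fun _ => rfl
  have hcomm : ∀ x y : G, x + y = y + x := by
    intro x y
    rw [add_def, add_def, dinv y x, mul_inv_eq_iff_eq_mul, mul_assoc (y * x), dsq,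
      mem_center_iff.1 (hG x y), commutatorElement_def]
    group
  have hassoc : ∀ x y z : G, x + y + z = x + (y + z) := by
    intro x y z
    simp only [add_def, dl, dr, dcl _ _ (d_cen _ _), dcr _ _ (d_cen _ _), mul_one]
    rw [mul_assoc (x * y), dpow y x z]
    simp only [mul_assoc]
    rw [dpow z y (d y x * d z x)]
    simp only [mul_assoc]
  let _ : AddCommGroup G :=
    { add_assoc := hassoc
      zero_add := fun x => by rw [add_def, zero_def, dcr _ _ (one_mem _), mul_one, one_mul]
      add_zero := fun x => by rw [add_def, zero_def, dcl _ _ (one_mem _), mul_one, mul_one]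
      neg_add_cancel := fun x => by
        have : d x x⁻¹ = 1 := by simp [d, commutatorElement_def]
        rw [add_def, neg_def, zero_def, this, mul_one, inv_mul_cancel]
      add_comm := hcomm
      nsmul := nsmulRec
      zsmul := zsmulRec }
  have hnsmul : ∀ (k : ℕ) (x : G), k • x = x ^ k := by
    intro k x
    induction k with
    | zero => rw [zero_smul, pow_zero, zero_def]
    | succ k ih =>
      have : d x (x ^ k) = 1 := by
        have : Commute x (x ^ k) := Commute.self_pow x k
        simp only [d, commutatorElement_eq_one_iff_mul_comm.2 this, one_pow]
      rw [succ_nsmul, ih, add_def, this, mul_one, pow_succ]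
  have hcen : ∀ x z : G, z ∈ center G → x + z = x * z := fun x z hz => by
    rw [add_def, dcl z x hz, mul_one]
  let c : G →+ G →+ G := AddMonoidHom.mk' (fun x => AddMonoidHom.mk' (fun y => d x y) fun y z => by
      rw [add_def y z, dr, dr, dcr _ _ (d_cen _ _), mul_one, hcen _ _ (d_cen _ _)]) fun x y => by
    ext z
    change d (x + y) z = d x z + d y z
    rw [add_def x y, dl, dl, dcl _ _ (d_cen _ _), mul_one, hcen _ _ (d_cen _ _)]
  have hc : ∀ x y, c x y = d x y := fun _ _ => rfl
  refine ⟨inferInstance, c, fun x => by rw [hnsmul, hexp, zero_def], fun x y => ?_, fun x => ?_,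
    fun x y z => ?_⟩
  · rw [hc, hcen _ _ (d_cen _ _), add_def, dinv y x, inv_mul_cancel_right]
  · rw [hc, dself, zero_def]
  · rw [hc y z, hc, dcr _ _ (d_cen _ _), zero_def]

theorem exists_baer_linearization {p : ℕ} [hp : Fact p.Prime] (hp2 : p ≠ 2) {G : Type u} [Group G]
    (hG : ∀ x y : G, ⁅x, y⁆ ∈ center G) (hexp : ∀ x : G, x ^ p = 1) :
    ∃ (E : Type u) (_ : AddCommGroup E) (_ : Module (ZMod p) E) (ε : G ≃ E)
      (c : E →ₗ[ZMod p] E →ₗ[ZMod p] E),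
      (∀ x y, ε (x * y) = ε x + ε y + c (ε x) (ε y)) ∧ (∀ x, c x x = 0) ∧
      ∀ x y z, c x (c y z) = 0 := by
  obtain ⟨A, c, hA, h1, h2, h3⟩ := exists_baer_addCommGroup hp2 hG hexp
  exact ⟨G, A, AddCommGroup.zmodModule hA, Equiv.refl G,
    @zmodBilinear p G G A (AddCommGroup.zmodModule hA) A (AddCommGroup.zmodModule hA) c, h1, h2, h3⟩

end

/-! ### Group ranks as dimensions -/

section
open Subgroup commutatorElement

/-- Additive subgroups of a `ZMod p`-module are subspaces, so generating and spanning sets coincide.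
-/
theorem rank_multiplicative_eq_finrank {p : ℕ} [Fact p.Prime] (M : Type*) [AddCommGroup M]
    [Module (ZMod p) M] [Finite M] : Group.rank (Multiplicative M) = Module.finrank (ZMod p) M := by
  classical
  apply le_antisymm
  · let b := Module.finBasis (ZMod p) M
    have hcl : closure ((Finset.univ.image fun i => Multiplicative.ofAdd (b i) :
        Finset (Multiplicative M)) : Set (Multiplicative M)) = ⊤ := by
      set K := closure ((Finset.univ.image fun i => Multiplicative.ofAdd (b i) :
        Finset (Multiplicative M)) : Set (Multiplicative M)) with hK
      have hQ : AddSubgroup.toZModSubmodule p (AddSubgroup.toSubgroup.symm K) = ⊤ := by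
        rw [eq_top_iff, ← b.span_eq, Submodule.span_le]
        rintro _ ⟨i, rfl⟩
        have hi : Multiplicative.ofAdd (b i) ∈ K := Subgroup.subset_closure
          (Finset.mem_coe.2 (Finset.mem_image_of_mem _ (Finset.mem_univ i)))
        exact hi
      rw [eq_top_iff]
      intro x _
      have : Multiplicative.toAdd x ∈
          AddSubgroup.toZModSubmodule p (AddSubgroup.toSubgroup.symm K) := by
        rw [hQ]; trivial
      exact this
    refine (Group.rank_le hcl).trans (Finset.card_image_le.trans ?_)
    simp
  · obtain ⟨S, hS, hcl⟩ := Group.rank_spec (Multiplicative M)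
    have htop : Submodule.span (ZMod p) ((S.image Multiplicative.toAdd : Finset M) : Set M) = ⊤ := by
      set P := Submodule.span (ZMod p) ((S.image Multiplicative.toAdd : Finset M) : Set M) with hP
      have hle : closure (S : Set (Multiplicative M)) ≤ AddSubgroup.toSubgroup P.toAddSubgroup := by
        rw [closure_le]
        intro x hx
        have hxP : Multiplicative.toAdd x ∈ P :=
          Submodule.subset_span (Finset.mem_coe.2 (Finset.mem_image_of_mem _ hx))
        exact hxP
      refine eq_top_iff.2 ?_
      intro (x : M) _
      have : Multiplicative.ofAdd x ∈ closure (S : Set (Multiplicative M)) := by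
        rw [hcl]; trivial
      exact hle this
    rw [← hS, ← finrank_top (ZMod p) M, ← htop]
    exact (finrank_span_finset_le_card _).trans Finset.card_image_le

theorem alternating_swap {R M N : Type*} [CommRing R] [AddCommGroup M] [Module R M]
    [AddCommGroup N] [Module R N] {c : M →ₗ[R] M →ₗ[R] N} (halt : ∀ x, c x x = 0) (x y : M) :
    c x y = - c y x := by
  have := halt (x + y)
  simp only [map_add, LinearMap.add_apply, halt, zero_add, add_zero] at this
  exact eq_neg_of_add_eq_zero_right this

section
variable {p : ℕ} [Fact p.Prime] {G : Type u} [Group G] {E : Type u} [AddCommGroup E]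
  [Module (ZMod p) E] (ε : G ≃ E) (c : E →ₗ[ZMod p] E →ₗ[ZMod p] E)

theorem linearization_one (hmul : ∀ x y, ε (x * y) = ε x + ε y + c (ε x) (ε y))
    (halt : ∀ x, c x x = 0) : ε 1 = 0 := by
  have := hmul 1 1
  rw [mul_one, halt, add_zero] at this
  exact left_eq_add.1 this

theorem linearization_commute_iff (h2 : (2 : ZMod p) ≠ 0)
    (hmul : ∀ x y, ε (x * y) = ε x + ε y + c (ε x) (ε y)) (halt : ∀ x, c x x = 0) (x y : G) :
    x * y = y * x ↔ c (ε x) (ε y) = 0 := by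
  rw [← ε.injective.eq_iff, hmul, hmul, add_comm (ε y), add_right_inj,
    alternating_swap halt (ε y), ← add_eq_zero_iff_eq_neg, ← two_smul (ZMod p), smul_eq_zero]
  simp [h2]

/-- The twist `c` takes values in `ker c`, so `ε` becomes a homomorphism modulo `ker c`; its kernel
is the center. -/
theorem rank_quotient_center_eq_finrank [Finite G] (h2 : (2 : ZMod p) ≠ 0)
    (hmul : ∀ x y, ε (x * y) = ε x + ε y + c (ε x) (ε y)) (halt : ∀ x, c x x = 0)
    (hcc : ∀ x y z, c x (c y z) = 0) :
    Group.rank (G ⧸ center G) = Module.finrank (ZMod p) (E ⧸ LinearMap.ker c) := by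
  have : Finite E := Finite.of_equiv G ε
  let φ : G →* Multiplicative (E ⧸ LinearMap.ker c) :=
    MonoidHom.mk' (fun x => Multiplicative.ofAdd ((LinearMap.ker c).mkQ (ε x))) fun x y => by
      rw [← ofAdd_add, hmul, map_add ((LinearMap.ker c).mkQ), map_add ((LinearMap.ker c).mkQ)]
      have : (LinearMap.ker c).mkQ (c (ε x) (ε y)) = 0 := by
        rw [Submodule.mkQ_apply, Submodule.Quotient.mk_eq_zero, LinearMap.mem_ker]
        ext z
        rw [alternating_swap halt, hcc, neg_zero, LinearMap.zero_apply]
      rw [this, add_zero]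
  have hφ : Function.Surjective φ := by
    intro y
    obtain ⟨x, hx⟩ := (LinearMap.ker c).mkQ_surjective (Multiplicative.toAdd y)
    refine ⟨ε.symm x, ?_⟩
    change Multiplicative.ofAdd ((LinearMap.ker c).mkQ (ε (ε.symm x))) = y
    rw [Equiv.apply_symm_apply, hx, ofAdd_toAdd]
  have hker : φ.ker = center G := by
    ext x
    have : φ x = 1 ↔ (LinearMap.ker c).mkQ (ε x) = 0 := Iff.rfl
    rw [MonoidHom.mem_ker, this, Submodule.mkQ_apply, Submodule.Quotient.mk_eq_zero,
      LinearMap.mem_ker, mem_center_iff]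
    constructor
    · intro h y
      rw [eq_comm, linearization_commute_iff ε c h2 hmul halt, h, LinearMap.zero_apply]
    · intro h
      ext y
      obtain ⟨y, rfl⟩ := ε.surjective y
      rw [(linearization_commute_iff ε c h2 hmul halt x y).1 (h y).symm, LinearMap.zero_apply]
  have : Finite (E ⧸ LinearMap.ker c) := Finite.of_surjective _ (LinearMap.ker c).mkQ_surjective
  rw [← rank_multiplicative_eq_finrank]
  exact Group.rank_congr ((QuotientGroup.quotientMulEquivOfEq hker).symm.trans
    (QuotientGroup.quotientKerEquivOfSurjective φ hφ))

/-- Commutators become `2 c`, and the twist is trivial on `L`, so `ε` identifies the commutator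
subgroup with `L`. Only this inequality is needed, since a larger span only helps. -/
theorem rank_commutator_le_finrank [Finite G] (h2 : (2 : ZMod p) ≠ 0)
    (hmul : ∀ x y, ε (x * y) = ε x + ε y + c (ε x) (ε y)) (halt : ∀ x, c x x = 0)
    (hcc : ∀ x y z, c x (c y z) = 0) :
    Group.rank (commutator G) ≤ Module.finrank (ZMod p)
      (Submodule.span (ZMod p) (Set.range fun q : E × E => c q.1 q.2)) := by
  have : Finite E := Finite.of_equiv G ε
  set L := Submodule.span (ZMod p) (Set.range fun q : E × E => c q.1 q.2) with hL
  have hcL : ∀ x, ∀ y ∈ L, c x y = 0 := by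
    intro x
    change L ≤ LinearMap.ker (c x)
    rw [hL, Submodule.span_le]
    rintro _ ⟨q, rfl⟩
    exact hcc _ _ _
  have hmem : ∀ x y, c x y ∈ L := fun x y => Submodule.subset_span ⟨(x, y), rfl⟩
  have hpow : ∀ (x : G) (k : ℕ), ε (x ^ k) = k • ε x := by
    intro x k
    induction k with
    | zero => rw [pow_zero, zero_smul, linearization_one ε c hmul halt]
    | succ k ih => rw [pow_succ, hmul, ih, map_nsmul, LinearMap.smul_apply, halt, smul_zero,
        add_zero, succ_nsmul]
  have hcomm : ∀ x y : G, ε ⁅x, y⁆ = (2 : ZMod p) • c (ε x) (ε y) := by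
    intro x y
    have e1 : ε.symm ((2 : ZMod p) • c (ε x) (ε y)) * (y * x) = x * y := by
      rw [← ε.injective.eq_iff, hmul, hmul, hmul, Equiv.apply_symm_apply,
        alternating_swap halt ((2 : ZMod p) • _), map_smul, hcc, smul_zero, neg_zero, add_zero,
        two_smul, alternating_swap halt (ε y)]
      abel
    rw [← Equiv.eq_symm_apply, commutatorElement_def, mul_inv_eq_iff_eq_mul,
      mul_inv_eq_iff_eq_mul, mul_assoc, e1]
  have hsub : ∀ x ∈ L, ε.symm x ∈ commutator G := by
    intro x hx
    induction hx using Submodule.span_induction with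
    | mem x hx =>
      obtain ⟨⟨x, y⟩, rfl⟩ := hx
      have : ε.symm (c x y) = ⁅ε.symm ((2 : ZMod p)⁻¹ • x), ε.symm y⁆ := by
        rw [Equiv.symm_apply_eq, hcomm, Equiv.apply_symm_apply, Equiv.apply_symm_apply, map_smul,
          LinearMap.smul_apply, smul_smul, mul_inv_cancel₀ h2, one_smul]
      rw [this]
      exact commutator_mem_commutator (mem_top _) (mem_top _)
    | zero => rw [← linearization_one ε c hmul halt, Equiv.symm_apply_apply]; exact one_mem _
    | add x y _ hyL hx hy =>
      have : ε.symm (x + y) = ε.symm x * ε.symm y := by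
        rw [Equiv.symm_apply_eq, hmul]
        simp [hcL x y hyL]
      rw [this]; exact mul_mem hx hy
    | smul r x _ hx =>
      have : ε.symm (r • x) = ε.symm x ^ r.val := by
        rw [Equiv.symm_apply_eq, hpow, Equiv.apply_symm_apply, ← Nat.cast_smul_eq_nsmul (ZMod p),
          ZMod.natCast_zmod_val]
      rw [this]; exact pow_mem hx _
  have hsup : ∀ g ∈ commutator G, ε g ∈ L := by
    let φ : G →* Multiplicative (E ⧸ L) :=
      MonoidHom.mk' (fun x => Multiplicative.ofAdd (L.mkQ (ε x))) fun x y => by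
        rw [← ofAdd_add, hmul, map_add L.mkQ, map_add L.mkQ]
        have : L.mkQ (c (ε x) (ε y)) = 0 := by
          rw [Submodule.mkQ_apply, Submodule.Quotient.mk_eq_zero]
          exact hmem _ _
        rw [this, add_zero]
    intro g hg
    have hg : φ g = 1 := Abelianization.commutator_subset_ker φ hg
    have : φ g = 1 ↔ L.mkQ (ε g) = 0 := Iff.rfl
    rwa [this, Submodule.mkQ_apply, Submodule.Quotient.mk_eq_zero] at hg
  let ψ : Multiplicative L →* commutator G :=
    MonoidHom.mk' (fun x => ⟨ε.symm (Multiplicative.toAdd x).1, hsub _ (Multiplicative.toAdd x).2⟩)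
      fun x y => by
        refine Subtype.ext ?_
        rw [Subgroup.coe_mul, Equiv.symm_apply_eq, hmul]
        simp [hcL _ _ (Multiplicative.toAdd y).2]
  rw [← rank_multiplicative_eq_finrank]
  refine Group.rank_le_of_surjective ψ fun g => ⟨Multiplicative.ofAdd ⟨ε g, hsup _ g.2⟩, ?_⟩
  exact Subtype.ext (ε.symm_apply_apply _)

end

end

/-! ### Construction of the cocycles and conclusion -/

section
open Subgroup commutatorElement
variable {p : ℕ} [Fact p.Prime] {G : Type u} [Group G] {E : Type u} [AddCommGroup E]
  [Module (ZMod p) E] [FiniteDimensional (ZMod p) E]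

theorem isCapable_of_linearization (ε : G ≃ E) (c : E →ₗ[ZMod p] E →ₗ[ZMod p] E)
    (h2 : (2 : ZMod p) ≠ 0) (hmul : ∀ x y, ε (x * y) = ε x + ε y + c (ε x) (ε y))
    (halt : ∀ x, c x x = 0) (hcc : ∀ x y z, c x (c y z) = 0) {n : ℕ}
    (hn : Module.finrank (ZMod p) (E ⧸ LinearMap.ker c) = n)
    (hlt : (n.choose 2 - Module.finrank (ZMod p)
      (Submodule.span (ZMod p) (Set.range fun q : E × E => c q.1 q.2))) ^ 2 < 4 * n) :
    IsCapable G := by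
  set L := Submodule.span (ZMod p) (Set.range fun q : E × E => c q.1 q.2) with hL
  let b := Module.finBasisOfFinrankEq (ZMod p) (E ⧸ LinearMap.ker c) hn
  let e : E →ₗ[ZMod p] (Fin n → ZMod p) := b.equivFun.toLinearMap.comp (LinearMap.ker c).mkQ
  choose g hg using fun i => (LinearMap.ker c).mkQ_surjective (b i)
  have he0 : ∀ x, c x = 0 → e x = 0 := by
    intro x hx
    change b.equivFun ((LinearMap.ker c).mkQ x) = 0
    rw [Submodule.mkQ_apply, (Submodule.Quotient.mk_eq_zero _).2 (LinearMap.mem_ker.2 hx), map_zero]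
  have heg : ∀ i, e (g i) = Pi.single i 1 := by
    intro i
    change b.equivFun ((LinearMap.ker c).mkQ (g i)) = _
    rw [hg]
    ext j
    rw [Module.Basis.equivFun_self, Pi.single_apply]
    simp only [eq_comm]
  have hccl : ∀ x y, c (c x y) = 0 := by
    intro x y
    ext z
    rw [alternating_swap halt, hcc, neg_zero, LinearMap.zero_apply]
  have hLker : ∀ x ∈ L, c x = 0 := by
    change L ≤ LinearMap.ker c
    rw [hL, Submodule.span_le]
    rintro _ ⟨q, rfl⟩
    exact hccl _ _
  have hec : ∀ x y, e (c x y) = 0 := fun x y => he0 _ (hccl x y)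
  have hexpand : ∀ x, c x = ∑ i, e x i • c (g i) := by
    intro x
    have : x - ∑ i, e x i • g i ∈ LinearMap.ker c := by
      rw [← Submodule.Quotient.mk_eq_zero, ← Submodule.mkQ_apply, map_sub, map_sum, sub_eq_zero]
      simp only [map_smul, hg]
      exact (b.sum_equivFun _).symm
    rw [LinearMap.mem_ker, map_sub, map_sum, sub_eq_zero] at this
    simpa only [map_smul] using this
  have hexpand2 : ∀ x y, c x y = ∑ i, ∑ j, (e x i * e y j) • c (g i) (g j) := by
    intro x y
    rw [hexpand x, LinearMap.sum_apply]
    refine Finset.sum_congr rfl fun i _ => ?_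
    rw [LinearMap.smul_apply, alternating_swap halt, hexpand y, LinearMap.sum_apply,
      ← Finset.sum_neg_distrib, Finset.smul_sum]
    refine Finset.sum_congr rfl fun j _ => ?_
    rw [LinearMap.smul_apply, ← smul_neg, ← alternating_swap halt, smul_smul]
  have hspan : Module.finrank (ZMod p) L ≤ Module.finrank (ZMod p) (Submodule.span (ZMod p)
      (Set.range fun q : Fin n × Fin n => c (g q.1) (g q.2))) := by
    apply Submodule.finrank_mono
    rw [hL, Submodule.span_le]
    rintro _ ⟨⟨x, y⟩, rfl⟩
    simp only [SetLike.mem_coe]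
    rw [hexpand2]
    exact Submodule.sum_mem _ fun i _ => Submodule.sum_mem _ fun j _ =>
      Submodule.smul_mem _ _ (Submodule.subset_span ⟨(i, j), rfl⟩)
  have hε1 : ε 1 = 0 := linearization_one ε c hmul halt
  refine isCapable_of_cocycles (A := ZMod p) fun z hz => ?_
  have hz0 : ε z ≠ 0 := fun h => hz (ε.injective (h.trans hε1.symm))
  by_cases hzL : ε z ∈ L
  · obtain ⟨B, hB, k, hk⟩ := exists_jacobi_apply_ne_zero h2 (fun i j => c (g i) (g j))
      (fun i j => alternating_swap halt _ _) hz0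
      (lt_of_le_of_lt (Nat.pow_le_pow_left (Nat.sub_le_sub_left hspan _) 2) hlt)
    obtain ⟨q, q1, q2, q3⟩ := sum_coordMonomial_mem_trilinearCoboundaries h2
      (fun i j k => - B k (c (g i) (g j)))
      (fun i j k => by linear_combination - hB i j k)
    have hT : ∀ x y w, q (e x) (e y) + q (e x + e y) (e w) - q (e y) (e w) - q (e x) (e y + e w) =
        - ∑ m, B m (c x y) * e w m := by
      intro x y w
      rw [q3]
      simp only [Finset.sum_apply, Pi.smul_apply, coordMonomial, smul_eq_mul, hexpand2 x y,
        map_sum, map_smul, Finset.sum_mul]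
      have hS : ∀ f : Fin n → Fin n → Fin n → ZMod p,
          ∑ m, ∑ i, ∑ j, f i j m = ∑ i, ∑ j, ∑ m, f i j m := fun f => by
        rw [Finset.sum_comm]
        exact Finset.sum_congr rfl fun i _ => Finset.sum_comm
      rw [hS fun i j m => e x i * e y j * B m (c (g i) (g j)) * e w m]
      simp only [← Finset.sum_neg_distrib]
      refine Finset.sum_congr rfl fun i _ => Finset.sum_congr rfl fun j _ =>
        Finset.sum_congr rfl fun k _ => ?_
      ring
    have he : e (ε z) = 0 := he0 _ (hLker _ hzL)
    -- The function `q` cancels the coboundary of the first term. As `e (ε z) = 0`, the values at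
    -- `(z, g k)` and `(g k, z)` are `B k (ε z)` and 0.
    refine ⟨fun x y => ∑ m, B m (ε x) * e (ε y) m + q (e (ε x)) (e (ε y)), ?_, ?_,
      ε.symm (g k), Or.inr ?_⟩
    · intro x
      simp [hε1, q1]
    · intro x y w
      have := hT (ε x) (ε y) (ε w)
      simp only [hmul, map_add, hec, add_zero, Pi.add_apply, mul_add, add_mul,
        Finset.sum_add_distrib, Pi.zero_apply]
      linear_combination this
    · simp only [he, q1, q2, Equiv.apply_symm_apply, heg, Pi.zero_apply, mul_zero,
        Finset.sum_const_zero, add_zero, Pi.single_apply, mul_ite, mul_one, Finset.sum_ite_eq',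
        Finset.mem_univ, if_true]
      exact hk
  · by_cases hzc : c (ε z) = 0
    · obtain ⟨l, hl, hlL⟩ := Submodule.exists_le_ker_of_notMem hzL
      have hn0 : 0 < n := by omega
      have hlc : ∀ x y, l (c x y) = 0 := fun x y => hlL (Submodule.subset_span ⟨(x, y), rfl⟩)
      -- Both factors are homomorphisms on `G`, so their product is a cocycle; the second one
      -- vanishes at the central element `z`.
      refine ⟨fun x y => l (ε x) * e (ε y) ⟨0, hn0⟩, ?_, ?_, ε.symm (g ⟨0, hn0⟩), Or.inr ?_⟩
      · intro x
        simp [hε1]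
      · intro x y w
        simp only [hmul, map_add, hec, hlc, add_zero, Pi.add_apply, Pi.zero_apply]
        ring
      · simp only [he0 _ hzc, Equiv.apply_symm_apply, heg, Pi.single_eq_same, mul_one,
          Pi.zero_apply, mul_zero]
        exact hl
    · refine ⟨fun _ _ => 0, fun _ => rfl, fun _ _ _ => rfl, ?_⟩
      by_contra! hcon
      refine hzc (LinearMap.ext fun y => ?_)
      have := (linearization_commute_iff ε c h2 hmul halt z (ε.symm y)).1 (hcon _).1
      rwa [Equiv.apply_symm_apply] at this

theorem commutatorElement_mem_center_of_nilpotencyClass_eq_two {G : Type*} [Group G]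
    [Group.IsNilpotent G] (h : Group.nilpotencyClass G = 2) (x y : G) : ⁅x, y⁆ ∈ center G := by
  have hc := Subgroup.lowerCentralSeries_nilpotencyClass (G := G)
  rw [h, Subgroup.lowerCentralSeries_succ, Subgroup.top_lowerCentralSeries_one,
    Subgroup.commutator_eq_bot_iff_le_centralizer, coe_top, centralizer_univ] at hc
  exact hc (commutator_mem_commutator (mem_top x) (mem_top y))

theorem nilpotencyClass_le_one_of_forall_commute {G : Type*} [Group G] [Group.IsNilpotent G]
    (h : ∀ x y : G, x * y = y * x) : Group.nilpotencyClass G ≤ 1 := by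
  rw [← Subgroup.lowerCentralSeries_eq_bot_iff_nilpotencyClass_le, Subgroup.top_lowerCentralSeries_one,
    commutator_def, Subgroup.commutator_eq_bot_iff_le_centralizer]
  exact fun x _ y _ => h y x

end

theorem mainTheorem7 (p : ℕ) [Fact p.Prime] (G : Type u) [Group G] [Finite G]
    (hpG : IsPGroup p G) (hclass : Group.nilpotencyClass G = 2) (hexp : Monoid.exponent G = p)
    (n ℓ : ℕ) (hn : Group.rank (G ⧸ Subgroup.center G) = n)
    (hℓ : Group.rank (commutator G) = ℓ)
    (h : (ℓ : ℝ) > (n.choose 2 : ℝ) - 2 * Real.sqrt n) :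
    IsCapable G := by
  have hnil : Group.IsNilpotent G := hpG.isNilpotent
  have hp2 : p ≠ 2 := by
    rintro rfl
    have := nilpotencyClass_le_one_of_forall_commute (mul_comm_of_exponent_two hexp)
    omega
  have hn0 : n ≠ 0 := by
    rintro rfl
    rw [Group.rank_eq_zero_iff, QuotientGroup.subsingleton_iff] at hn
    have := nilpotencyClass_le_one_of_forall_commute fun x y : G =>
      (Subgroup.mem_center_iff.1 (hn ▸ Subgroup.mem_top x : x ∈ Subgroup.center G) y).symm
    omega
  have h2 : (2 : ZMod p) ≠ 0 := by
    intro h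
    have h' : ((2 : ℕ) : ZMod p) = 0 := by exact_mod_cast h
    rw [ZMod.natCast_eq_zero_iff] at h'
    exact hp2 ((Nat.prime_dvd_prime_iff_eq Fact.out Nat.prime_two).1 h')
  obtain ⟨E, _, _, ε, c, hmul, halt, hcc⟩ := exists_baer_linearization hp2
    (commutatorElement_mem_center_of_nilpotencyClass_eq_two hclass) fun x => by rw [← hexp]; exact Monoid.pow_exponent_eq_one x
  have : Finite E := Finite.of_equiv G ε
  rw [rank_quotient_center_eq_finrank ε c h2 hmul halt hcc] at hn
  have hℓ' := rank_commutator_le_finrank ε c h2 hmul halt hcc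
  rw [hℓ] at hℓ'
  refine isCapable_of_linearization ε c h2 hmul halt hcc hn
    (lt_of_le_of_lt (Nat.pow_le_pow_left (Nat.sub_le_sub_left hℓ' _) 2) ?_)
  -- If `ℓ ≥ C(n,2)`, the truncated difference is 0 and `n ≠ 0` suffices.
  rcases le_total (n.choose 2) ℓ with hle | hle
  · rw [Nat.sub_eq_zero_of_le hle]
    omega
  · have h3 : ((n.choose 2 - ℓ : ℕ) : ℝ) < 2 * Real.sqrt n := by
      rw [Nat.cast_sub hle]; linarith
    have h4 : ((n.choose 2 - ℓ : ℕ) : ℝ) ^ 2 < 4 * n := by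
      calc _ < (2 * Real.sqrt n) ^ 2 := by gcongr
        _ = 4 * n := by rw [mul_pow, Real.sq_sqrt (Nat.cast_nonneg n)]; norm_num
    exact_mod_cast h4
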